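/- Let $X$ be a topological space. A neighborhood assignment on $X$ is a map $U$ assigning to each point $x\in X$ an open set $U(x)$ with $x\in U(x)$; a set $A\subseteq X$ pins down $U$ if $A\cap U(x)\neq\emptyset$ for all $x\in X$. The pinning down number $\mathrm{pd}(X)$ is the smallest cardinal $\kappa$ such that every neighborhood assignment on $X$ is pinned down by some set $A\subseteq X$ with $|A|\le\kappa$, and the density $d(X)$ is the smallest cardinality of a dense subset of $X$ (finite values are allowed for both). Theorem. For every regular space $X$ (a space in which every point and every closed set not containing it have disjoint neighborhoods; no $T_0$ or $T_1$ axiom is needed) we have $$d(X)<2^{\mathrm{pd}(X)}.$$ -/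

import Mathlib

universe u

open Cardinal

/-- A neighborhood assignment on `X`: every point `x` is assigned an open set `U x`
containing `x`. -/
def IsNeighborhoodAssignment {X : Type u} [TopologicalSpace X] (U : X → Set X) : Prop :=
  ∀ x : X, IsOpen (U x) ∧ x ∈ U x

/-- `A` pins down `U` if `A` meets `U x` for every `x`. -/
def PinsDown {X : Type u} (A : Set X) (U : X → Set X) : Prop :=
  ∀ x : X, (A ∩ U x).Nonempty

/-- The pinning down number `pd(X)`: the smallest cardinal `κ` such that every neighborhood
assignment on `X` is pinned down by a set of size at most `κ`. -/
noncomputable def pinningDownNumber (X : Type u) [TopologicalSpace X] : Cardinal.{u} :=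
  sInf {κ : Cardinal.{u} | ∀ U : X → Set X, IsNeighborhoodAssignment U →
    ∃ A : Set X, #A ≤ κ ∧ PinsDown A U}

/-- The density `d(X)`: the smallest cardinality of a dense subset of `X`
(finite values are allowed). -/
noncomputable def densityNumber (X : Type u) [TopologicalSpace X] : Cardinal.{u} :=
  sInf {κ : Cardinal.{u} | ∃ D : Set X, Dense D ∧ #D = κ}

/-- The infimum defining `pd(X)` is attained. -/
theorem pinningDownNumber_spec (X : Type u) [TopologicalSpace X] :
    ∀ U : X → Set X, IsNeighborhoodAssignment U →
      ∃ A : Set X, #A ≤ pinningDownNumber X ∧ PinsDown A U :=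
  csInf_mem (s := {κ : Cardinal.{u} | ∀ U : X → Set X, IsNeighborhoodAssignment U →
    ∃ A : Set X, #A ≤ κ ∧ PinsDown A U})
    ⟨#X, fun _ hU => ⟨Set.univ, Cardinal.mk_univ.le, fun x => ⟨x, Set.mem_univ x, (hU x).2⟩⟩⟩

/-- The infimum defining `d(X)` is attained. -/
theorem densityNumber_spec (X : Type u) [TopologicalSpace X] :
    ∃ D : Set X, Dense D ∧ #D = densityNumber X :=
  csInf_mem (s := {κ : Cardinal.{u} | ∃ D : Set X, Dense D ∧ #D = κ})
    ⟨#(Set.univ : Set X), Set.univ, dense_univ, rfl⟩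

/-!
Call an open set `V` neat if none of its nonempty open subsets has fewer points than `V`. A family
of at most `|V|` nonempty open subsets of a neat set `V` is met by a single set of size at most
`pd X`: choose distinct points in the members and use the members as their neighborhoods. For
infinite neat `V` this gives a set of size at most `pd X` whose closure contains `V` in two cases.

If `|V| ^ pd X ≤ |V|`, then `V` has at most `|V|` subsets `A` of size at most `pd X`. If none of
them were dense in `V`, a set of size at most `pd X` would meet all the sets `V \ closure A`,
including the one that comes from its own trace on `V`.

If `2 ^ pd X < |V|`, then `V` has at most `2 ^ pd X` regular open subsets: a set of size at most
`pd X` that meets the nonempty differences `U \ closure W` distinguishes them by their traces.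
Hence one set of size at most `pd X` meets all of these regular open sets, which form a π-base.

For infinite `pd X`, neat sets therefore have density below `2 ^ pd X`. A maximal disjoint family
of open sets of density below `2 ^ pd X` has at most `pd X` members and a dense union, and
`pd X < cof (2 ^ pd X)` by König's theorem. For finite `pd X`, the first case shows in the same way
that `d X` is finite, and the points of a minimal finite dense set lie in disjoint open sets, so
that `d X ≤ pd X`.
-/

theorem exists_injective_forall_mem {ι α : Type u} {V : ι → Set α} (h : ∀ i, #ι ≤ #(V i)) :
    ∃ f : ι → α, Function.Injective f ∧ ∀ i, f i ∈ V i := by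
  obtain ⟨_, _, hord⟩ := exists_ord_eq_type_lt ι
  have exists_fresh (i : ι) (g : ∀ j < i, α) : ∃ x ∈ V i, ∀ j hj, g j hj ≠ x := by
    have hlt : #(Set.range fun j : Set.Iio i => g j j.2) < #(V i) :=
      mk_range_le.trans_lt ((mk_Iio_lt i hord).trans_le (h i))
    obtain ⟨x, hxV, hx⟩ := sdiff_nonempty_of_mk_lt_mk hlt
    exact ⟨x, hxV, fun j hj hjx => hx ⟨⟨j, hj⟩, hjx⟩⟩
  choose next next_mem ne_next using exists_fresh
  let f : ι → α := WellFoundedLT.fix next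
  have hf (i : ι) : f i = next i fun j _ => f j := WellFoundedLT.fix_eq next i
  have f_ne (i j : ι) (hij : i < j) : f i ≠ f j := by
    rw [hf j]
    exact ne_next j (fun k _ => f k) i hij
  refine ⟨f, .of_lt_imp_ne f_ne, fun i => ?_⟩
  rw [hf i]
  exact next_mem i _

theorem exists_pairwiseDisjoint_dense_sUnion {X : Type u} [TopologicalSpace X] {P : Set (Set X)}
    (hPne : ∀ V ∈ P, V.Nonempty) (hP : ∀ G, IsOpen G → G.Nonempty → ∃ V ∈ P, V ⊆ G) :
    ∃ S ⊆ P, S.PairwiseDisjoint id ∧ Dense (⋃₀ S) := by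
  obtain ⟨S, hS⟩ := zorn_subset {S | S ⊆ P ∧ S.PairwiseDisjoint id} fun c hc hchain =>
    ⟨⋃₀ c, ⟨Set.sUnion_subset fun S hS => (hc hS).1,
      (Set.pairwiseDisjoint_sUnion hchain.directedOn).2 fun S hS => (hc hS).2⟩,
      fun S => Set.subset_sUnion_of_mem⟩
  refine ⟨S, hS.prop.1, hS.prop.2, dense_iff_inter_open.2 fun G hG hGne => ?_⟩
  by_contra hGS
  rw [← Set.not_disjoint_iff_nonempty_inter, not_not] at hGS
  obtain ⟨V, hVP, hVG⟩ := hP G hG hGne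
  have disjoint_V (W) (hW : W ∈ S) : Disjoint V W := hGS.mono hVG (Set.subset_sUnion_of_mem hW)
  have V_mem : V ∈ S := hS.mem_of_prop_insert
    ⟨Set.insert_subset hVP hS.prop.1, hS.prop.2.insert fun W hW _ => disjoint_V W hW⟩
  exact (hPne V hVP).ne_empty (disjoint_self.1 (disjoint_V V V_mem))

section RegularOpen

variable {X : Type u} [TopologicalSpace X]

/-- A regular open set, that is, one equal to the interior of its closure. -/
def IsRegularOpen (V : Set X) : Prop :=
  interior (closure V) = V

theorem IsRegularOpen.isOpen {V : Set X} (hV : IsRegularOpen V) : IsOpen V :=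
  hV ▸ isOpen_interior

theorem IsRegularOpen.subset_of_subset_closure {V W : Set X} (hW : IsRegularOpen W)
    (hV : IsOpen V) (h : V ⊆ closure W) : V ⊆ W :=
  hW ▸ interior_maximal h hV

theorem isRegularOpen_interior {C : Set X} (hC : IsClosed C) : IsRegularOpen (interior C) :=
  (interior_mono (closure_minimal interior_subset hC)).antisymm
    isOpen_interior.subset_interior_closure

theorem exists_isRegularOpen_subset [RegularSpace X] {G : Set X} (hG : IsOpen G)
    (hGne : G.Nonempty) : ∃ V ⊆ G, V.Nonempty ∧ IsRegularOpen V := by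
  obtain ⟨x, hx⟩ := hGne
  obtain ⟨C, hCx, hC, hCG⟩ := exists_mem_nhds_isClosed_subset (hG.mem_nhds hx)
  exact ⟨interior C, interior_subset.trans hCG, ⟨x, mem_interior_iff_mem_nhds.2 hCx⟩,
    isRegularOpen_interior hC⟩

end RegularOpen

section PinningDown

variable {X : Type u} [TopologicalSpace X]

theorem densityNumber_le_mk {D : Set X} (hD : Dense D) : densityNumber X ≤ #D :=
  csInf_le' ⟨D, hD, rfl⟩

theorem exists_mk_le_pinningDownNumber_of_injective {ι : Type u} {f : ι → X}
    (hf : Function.Injective f) {V : ι → Set X} (hV : ∀ i, IsOpen (V i)) (hfV : ∀ i, f i ∈ V i) :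
    ∃ A : Set X, #A ≤ pinningDownNumber X ∧ ∀ i, (A ∩ V i).Nonempty := by
  have assignment : IsNeighborhoodAssignment (Function.extend f V fun _ => Set.univ) := by
    intro x
    by_cases hx : ∃ i, f i = x
    · obtain ⟨i, rfl⟩ := hx
      rw [hf.extend_apply]
      exact ⟨hV i, hfV i⟩
    · rw [Function.extend_apply' _ _ _ hx]
      exact ⟨isOpen_univ, Set.mem_univ x⟩
  obtain ⟨A, hA, hAV⟩ := pinningDownNumber_spec X _ assignment
  exact ⟨A, hA, fun i => by simpa only [hf.extend_apply] using hAV (f i)⟩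

theorem mk_le_pinningDownNumber_of_pairwise_disjoint {ι : Type u} {V : ι → Set X}
    (hV : ∀ i, IsOpen (V i)) (hne : ∀ i, (V i).Nonempty)
    (hd : Pairwise (Function.onFun Disjoint V)) : #ι ≤ pinningDownNumber X := by
  have injective_of_mem {g : ι → X} (hg : ∀ i, g i ∈ V i) : Function.Injective g :=
    fun i j hij => hd.eq (Set.not_disjoint_iff.2 ⟨g i, hg i, hij ▸ hg j⟩)
  choose f hf using hne
  obtain ⟨A, hA, hAV⟩ :=
    exists_mk_le_pinningDownNumber_of_injective (injective_of_mem hf) hV hf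
  choose g hgA hgV using hAV
  exact (mk_le_of_injective ((injective_of_mem hgV).codRestrict hgA)).trans hA

theorem densityNumber_le_pinningDownNumber (hd : densityNumber X < ℵ₀) :
    densityNumber X ≤ pinningDownNumber X := by
  classical
  obtain ⟨D₀, hD₀, hD₀card⟩ := densityNumber_spec X
  have hD₀fin : D₀.Finite := lt_aleph0_iff_set_finite.1 (hD₀card ▸ hd)
  obtain ⟨D, hD, hDmin⟩ := exists_minimal_of_wellFoundedLT (fun D : Finset X => Dense (D : Set X))
    ⟨hD₀fin.toFinset, by simpa only [hD₀fin.coe_toFinset] using hD₀⟩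
  have not_dense_erase (a : D) : ¬ Dense (D.erase a.1 : Set X) := fun h =>
    D.notMem_erase a.1 (hDmin h (D.erase_subset a.1) a.2)
  have eq_of_notMem_closure {a c : X} (hc : c ∈ D) (hca : c ∉ closure (D.erase a : Set X)) :
      c = a := by
    by_contra hne
    exact hca (subset_closure (Finset.mem_erase.2 ⟨hne, hc⟩))
  refine (densityNumber_le_mk hD).trans <| mk_le_pinningDownNumber_of_pairwise_disjoint
    (V := fun a : D => (closure (D.erase a.1 : Set X))ᶜ) (fun a => isClosed_closure.isOpen_compl)
    (fun a => Set.nonempty_compl.2 (mt dense_iff_closure_eq.2 (not_dense_erase a)))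
    fun a b hab => ?_
  by_contra hmeet
  obtain ⟨c, ⟨hca, hcb⟩, hc⟩ := hD.inter_open_nonempty _
    (isClosed_closure.isOpen_compl.inter isClosed_closure.isOpen_compl)
    (Set.not_disjoint_iff_nonempty_inter.1 hmeet)
  exact hab (Subtype.ext <|
    (eq_of_notMem_closure hc hca).symm.trans (eq_of_notMem_closure hc hcb))

theorem densityNumber_lt_of_forall_exists_isOpen {μ : Cardinal.{u}} (hμ : ℵ₀ ≤ μ)
    (hcof : pinningDownNumber X < μ.ord.cof)
    (h : ∀ G : Set X, IsOpen G → G.Nonempty →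
      ∃ V ⊆ G, IsOpen V ∧ V.Nonempty ∧ ∃ D : Set X, #D < μ ∧ V ⊆ closure D) :
    densityNumber X < μ := by
  obtain ⟨S, hSP, hSd, hSdense⟩ := exists_pairwiseDisjoint_dense_sUnion
    (P := {V : Set X | IsOpen V ∧ V.Nonempty ∧ ∃ D : Set X, #D < μ ∧ V ⊆ closure D})
    (fun V hV => hV.2.1)
    (fun G hG hGne => let ⟨V, hVG, hV⟩ := h G hG hGne; ⟨V, hV, hVG⟩)
  have hS : #S < μ.ord.cof := (mk_le_pinningDownNumber_of_pairwise_disjoint (V := ((↑) : S → Set X))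
    (fun V => (hSP V.2).1) (fun V => (hSP V.2).2.1) hSd.subtype).trans_lt hcof
  choose D hDlt hVD using fun V : S => (hSP V.2).2.2
  have dense_iUnion : Dense (⋃ V, D V) := .of_closure <| hSdense.mono <|
    Set.sUnion_subset fun V hV =>
      (hVD ⟨V, hV⟩).trans (closure_mono (Set.subset_iUnion D ⟨V, hV⟩))
  calc densityNumber X ≤ #(⋃ V, D V) := densityNumber_le_mk dense_iUnion
    _ ≤ #S * ⨆ V, #(D V) := mk_iUnion_le D
    _ < μ := mul_lt_of_lt hμ (hS.trans_le (Ordinal.cof_ord_le μ)) (iSup_lt_of_lt_cof_ord hS hDlt)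

/-- A nonempty open set, all of whose nonempty open subsets have the same cardinality as the set
itself: its cardinality and its dispersion character agree. -/
structure IsNeat (V : Set X) : Prop where
  isOpen : IsOpen V
  nonempty : V.Nonempty
  mk_le : ∀ W ⊆ V, IsOpen W → W.Nonempty → #V ≤ #W

theorem exists_isNeat_subset {G : Set X} (hG : IsOpen G) (hGne : G.Nonempty) :
    ∃ V ⊆ G, IsNeat V := by
  obtain ⟨V, ⟨hVG, hV, hVne⟩, hmin⟩ := exists_minimalFor_of_wellFoundedLT
    (fun V : Set X => V ⊆ G ∧ IsOpen V ∧ V.Nonempty) (fun V => #V) ⟨G, subset_rfl, hG, hGne⟩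
  refine ⟨V, hVG, hV, hVne, fun W hWV hW hWne => ?_⟩
  exact (le_total #V #W).elim id (hmin ⟨hWV.trans hVG, hW, hWne⟩)

namespace IsNeat

variable {V : Set X}

theorem exists_forall_inter_nonempty (hV : IsNeat V) {ι : Type u} (hι : #ι ≤ #V) {U : ι → Set X}
    (hU : ∀ i, IsOpen (U i)) (hUne : ∀ i, (U i).Nonempty) (hUV : ∀ i, U i ⊆ V) :
    ∃ A : Set X, #A ≤ pinningDownNumber X ∧ ∀ i, (A ∩ U i).Nonempty := by
  obtain ⟨f, hf, hfU⟩ := exists_injective_forall_mem fun i =>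
    hι.trans (hV.mk_le (U i) (hUV i) (hU i) (hUne i))
  exact exists_mk_le_pinningDownNumber_of_injective hf hU hfU

theorem exists_subset_closure_of_mk_power_le (hV : IsNeat V) (hinf : ℵ₀ ≤ #V)
    (hpow : #V ^ pinningDownNumber X ≤ #V) :
    ∃ A : Set X, #A ≤ pinningDownNumber X ∧ V ⊆ closure A := by
  by_contra! hA
  let ι := {A : Set X // A ⊆ V ∧ #A ≤ pinningDownNumber X}
  have mk_ι : #ι ≤ #V :=
    (mk_bounded_subset_le V (pinningDownNumber X)).trans (by rwa [max_eq_left hinf])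
  obtain ⟨B, hB, hBV⟩ := hV.exists_forall_inter_nonempty mk_ι (U := fun A => V \ closure A.1)
    (fun A => hV.isOpen.sdiff isClosed_closure) (fun A => Set.sdiff_nonempty.2 (hA A.1 A.2.2))
    (fun A => Set.sdiff_subset)
  obtain ⟨x, hxB, hxV, hx⟩ := hBV
    ⟨B ∩ V, Set.inter_subset_right, (mk_le_mk_of_subset Set.inter_subset_left).trans hB⟩
  exact hx (subset_closure ⟨hxB, hxV⟩)

theorem exists_injOn_inter (hV : IsNeat V) (hinf : ℵ₀ ≤ #V) {S : Set (Set X)} (hS : #S ≤ #V)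
    (hSV : ∀ U ∈ S, U ⊆ V ∧ IsRegularOpen U) :
    ∃ A : Set X, #A ≤ pinningDownNumber X ∧ S.InjOn (A ∩ ·) := by
  let ι := {p : S × S // (p.1.1 \ closure p.2.1).Nonempty}
  have mk_ι : #ι ≤ #V :=
    (mk_subtype_le _).trans ((mul_def S S).symm.trans_le (mul_le_of_le hinf hS hS))
  obtain ⟨A, hA, hAS⟩ := hV.exists_forall_inter_nonempty mk_ι
    (U := fun p => p.1.1.1 \ closure p.1.2.1)
    (fun p => (hSV _ p.1.1.2).2.isOpen.sdiff isClosed_closure) (fun p => p.2)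
    (fun p => Set.sdiff_subset.trans (hSV _ p.1.1.2).1)
  have subset_of_inter_eq {U W : Set X} (hU : U ∈ S) (hW : W ∈ S) (h : A ∩ U = A ∩ W) :
      U ⊆ W := by
    refine (hSV W hW).2.subset_of_subset_closure (hSV U hU).2.isOpen ?_
    by_contra hUW
    obtain ⟨x, hxA, hxU, hxW⟩ := hAS ⟨(⟨U, hU⟩, ⟨W, hW⟩), Set.sdiff_nonempty.2 hUW⟩
    have hxAW : x ∈ A ∩ W := h ▸ ⟨hxA, hxU⟩
    exact hxW (subset_closure hxAW.2)
  exact ⟨A, hA, fun U hU W hW h =>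
    (subset_of_inter_eq hU hW h).antisymm (subset_of_inter_eq hW hU h.symm)⟩

theorem mk_isRegularOpen_le (hV : IsNeat V) (hinf : ℵ₀ ≤ #V)
    (hlt : 2 ^ pinningDownNumber X < #V) :
    #{U : Set X | U ⊆ V ∧ IsRegularOpen U} ≤ 2 ^ pinningDownNumber X := by
  by_contra! hbig
  obtain ⟨S, hSV, hS⟩ := le_mk_iff_exists_subset.1 (Order.succ_le_of_lt hbig)
  obtain ⟨A, hA, hinj⟩ :=
    hV.exists_injOn_inter hinf (hS.trans_le (Order.succ_le_of_lt hlt)) hSV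
  have mk_S_le : #S ≤ 2 ^ pinningDownNumber X := calc
    #S = #((A ∩ ·) '' S) := (mk_image_eq_of_injOn _ _ hinj).symm
    _ ≤ #(𝒫 A) := mk_le_mk_of_subset (Set.image_subset_iff.2 fun U _ => Set.inter_subset_left)
    _ = 2 ^ #A := mk_powerset A
    _ ≤ 2 ^ pinningDownNumber X := power_le_power_left two_ne_zero hA
  exact (Order.lt_succ _).not_ge (hS ▸ mk_S_le)

theorem exists_subset_closure_of_two_power_lt (hV : IsNeat V) (hinf : ℵ₀ ≤ #V)
    (hlt : 2 ^ pinningDownNumber X < #V)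
    (hX : ∀ G : Set X, IsOpen G → G.Nonempty → ∃ U ⊆ G, U.Nonempty ∧ IsRegularOpen U) :
    ∃ A : Set X, #A ≤ pinningDownNumber X ∧ V ⊆ closure A := by
  let ι := {U : {U : Set X | U ⊆ V ∧ IsRegularOpen U} // U.1.Nonempty}
  have mk_ι : #ι ≤ #V :=
    (mk_subtype_le _).trans ((hV.mk_isRegularOpen_le hinf hlt).trans hlt.le)
  obtain ⟨A, hA, hAV⟩ := hV.exists_forall_inter_nonempty mk_ι (U := fun U => U.1.1)
    (fun U => U.1.2.2.isOpen) (fun U => U.2) (fun U => U.1.2.1)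
  refine ⟨A, hA, fun x hx => mem_closure_iff.2 fun O hO hxO => ?_⟩
  obtain ⟨U, hU, hUne, hUreg⟩ := hX (O ∩ V) (hO.inter hV.isOpen) ⟨x, hxO, hx⟩
  obtain ⟨y, hyA, hyU⟩ := hAV ⟨⟨U, hU.trans Set.inter_subset_right, hUreg⟩, hUne⟩
  exact ⟨y, (hU hyU).1, hyA⟩

end IsNeat

theorem densityNumber_lt_aleph0_of_pinningDownNumber_lt_aleph0 (h : pinningDownNumber X < ℵ₀) :
    densityNumber X < ℵ₀ := by
  refine densityNumber_lt_of_forall_exists_isOpen le_rfl (by rwa [isRegular_aleph0.cof_ord])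
    fun G hG hGne => ?_
  obtain ⟨V, hVG, hV⟩ := exists_isNeat_subset hG hGne
  refine ⟨V, hVG, hV.isOpen, hV.nonempty, ?_⟩
  rcases lt_or_ge #V ℵ₀ with hfin | hinf
  · exact ⟨V, hfin, subset_closure⟩
  · obtain ⟨A, hA, hVA⟩ := hV.exists_subset_closure_of_mk_power_le hinf (pow_le hinf h)
    exact ⟨A, hA.trans_lt h, hVA⟩

end PinningDown

theorem mainTheorem5_general (X : Type u) [TopologicalSpace X]
    (hX : ∀ G : Set X, IsOpen G → G.Nonempty → ∃ U ⊆ G, U.Nonempty ∧ IsRegularOpen U) :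
    densityNumber X < 2 ^ pinningDownNumber X := by
  rcases lt_or_ge (pinningDownNumber X) ℵ₀ with hfin | hω
  · have hd := densityNumber_lt_aleph0_of_pinningDownNumber_lt_aleph0 hfin
    exact (densityNumber_le_pinningDownNumber hd).trans_lt (cantor _)
  have hω' : ℵ₀ ≤ 2 ^ pinningDownNumber X := hω.trans (cantor _).le
  refine densityNumber_lt_of_forall_exists_isOpen hω' (lt_cof_ord_power hω one_lt_two)
    fun G hG hGne => ?_
  obtain ⟨V, hVG, hV⟩ := exists_isNeat_subset hG hGne
  refine ⟨V, hVG, hV.isOpen, hV.nonempty, ?_⟩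
  rcases lt_or_ge #V (2 ^ pinningDownNumber X) with hsmall | hlarge
  · exact ⟨V, hsmall, subset_closure⟩
  obtain ⟨A, hA, hVA⟩ : ∃ A : Set X, #A ≤ pinningDownNumber X ∧ V ⊆ closure A := by
    rcases hlarge.eq_or_lt with heq | hgt
    · refine hV.exists_subset_closure_of_mk_power_le (hω'.trans hlarge) ?_
      rw [← heq, ← power_mul, mul_eq_self hω]
    · exact hV.exists_subset_closure_of_two_power_lt (hω'.trans hlarge) hgt hX
  exact ⟨A, hA.trans_lt (cantor _), hVA⟩

theorem mainTheorem5 (X : Type u) [TopologicalSpace X] [RegularSpace X] :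
    densityNumber X < (2 : Cardinal.{u}) ^ pinningDownNumber X :=
  mainTheorem5_general X fun _ => exists_isRegularOpen_subset
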